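/- Let $[n]=\{1,\dots,n\}$. For distributions $p,q$ on $[n]$ let $\|p-q\|_1=\sum_x|p(x)-q(x)|$; sources $p_1,\dots,p_s$ satisfy the structural condition with respect to $q$ if there is a set $A\subseteq[n]$ such that for every $i$, $p_i(x)\ge q(x)$ for all $x\in A$ and $p_i(x)\le q(x)$ for all $x\in[n]\setminus A$. For $0<\varepsilon\le 2$, $0<k\le n$ and a constant $c_1>0$, put $s=\lceil c_1 n/(\varepsilon^2\sqrt k)\rceil$ and let Closeness-Tester be the following algorithm, which has sample access to an unknown distribution $q$ on $[n]$ and to unknown distributions $p_1,\dots,p_s$ on $[n]$. (1) Draw $\mathrm{Poi}(k)$ samples from $q$, let $b_x$ be one plus the number of occurrences of $x$ among them, and let $D=\{(x,y): x\in[n],\ y\in[b_x]\}$. Each sample $x$ drawn later is replaced by $(x,y)\in D$ with $y$ uniform in $[b_x]$. (2) Draw $\mathrm{Poi}(s)$ samples from $q$ and $\mathrm{Poi}(1)$ samples from each $p_i$ (all independently), and for $z\in D$ let $Y_z$ and $T_z$ be the number of occurrences of $z$ among the samples from $q$ and among the samples from the sources, respectively. (3) Compute $Z=\sum_{z\in D}\big((T_z-Y_z)^2-T_z-Y_z\big)$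 and reject if $Z\ge 5s^2\varepsilon^2/(8|D|)$; otherwise accept. There are absolute constants $c_1,C>0$ such that for all $n\ge1$, $0<\varepsilon\le2$ and $0<k\le n$, and all $q,p_1,\dots,p_s$, with $B=C\big(k+n/(\varepsilon^2\sqrt k)\big)$: - if $p_1=\dots=p_s=q$, then with probability at least $2/3$ the tester accepts and draws at most $B$ samples in total; - if $\|p_i-q\|_1\ge\varepsilon$ for all $i$ and the $p_i$ satisfy the structural condition with respect to $q$, then with probability at least $2/3$ the tester rejects and draws at most $B$ samples in total; - the expected total number of samples drawn is at most $B$. Moreover, for $k=\min\{n,\ n^{2/3}/\varepsilon^{4/3}\}$ all this holds (with the same constants) with $B=C\big(n^{2/3}/\varepsilon^{4/3}+\sqrt n/\varepsilon^2\big)$. -/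

import Mathlib

open scoped ENNReal NNReal

noncomputable section

namespace ClosenessTesting

/-- The `ℓ₁`-distance `‖p - q‖₁ = ∑ₓ |p(x) - q(x)|` of two distributions on `[n]`. -/
def l1Dist {n : ℕ} (p q : PMF (Fin n)) : ℝ :=
  ∑ x : Fin n, |(p x).toReal - (q x).toReal|

/-- The structural condition: there is a set `A` such that every source lies above `q` on `A`
and below `q` on the complement of `A`. -/
def StructuralCondition {n s : ℕ} (p : Fin s → PMF (Fin n)) (q : PMF (Fin n)) : Prop :=
  ∃ A : Set (Fin n), ∀ i : Fin s,
    (∀ x ∈ A, q x ≤ p i x) ∧ (∀ x ∈ Aᶜ, p i x ≤ q x)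

/-- `m` independent samples from `p`. -/
def iidSamples {α : Type} (p : PMF α) : ℕ → PMF (List α)
  | 0 => PMF.pure []
  | m + 1 => p.bind fun x => (iidSamples p m).bind fun xs => PMF.pure (x :: xs)

/-- `Poi(r)` independent samples from `p`. -/
def poissonSamples {α : Type} (r : ℝ≥0) (p : PMF α) : PMF (List α) :=
  (ProbabilityTheory.poissonMeasure r).toPMF.bind (iidSamples p)

/-- `Poi(1)` independent samples from each of the listed distributions, independently of each
other, put together in one list. -/
def sourceSamples {α : Type} : List (PMF α) → PMF (List α)
  | [] => PMF.pure []
  | p :: ps => (poissonSamples 1 p).bind fun xs =>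
      (sourceSamples ps).bind fun ys => PMF.pure (xs ++ ys)

/-- The number of buckets of `x` after flattening with the samples `F`: one plus the number of
occurrences of `x` in `F`. -/
def buckets {n : ℕ} (F : List (Fin n)) (x : Fin n) : ℕ := F.count x + 1

/-- The flattened domain `{(x, y) : x ∈ [n], y ∈ [bₓ]}`. -/
abbrev FlatDomain {n : ℕ} (F : List (Fin n)) : Type := Σ x : Fin n, Fin (buckets F x)

instance {n : ℕ} (F : List (Fin n)) (x : Fin n) : Nonempty (Fin (buckets F x)) :=
  ⟨⟨0, Nat.succ_pos _⟩⟩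

/-- The flattened distribution: draw `x` from `p`, then `y` uniformly from the buckets of `x`. -/
def flatten {n : ℕ} (F : List (Fin n)) (p : PMF (Fin n)) : PMF (FlatDomain F) :=
  p.bind fun x =>
    (PMF.uniformOfFintype (Fin (buckets F x))).bind fun y => PMF.pure ⟨x, y⟩

/-- The statistic `∑ₓ ((Tₓ - Yₓ)² - Tₓ - Yₓ)`, where `Tₓ` and `Yₓ` are the numbers of
occurrences of `x` in the lists `T` and `Y`. -/
def statistic {D : Type} [Fintype D] [DecidableEq D] (T Y : List D) : ℝ :=
  ∑ x : D, (((T.count x : ℝ) - (Y.count x : ℝ)) ^ 2 - (T.count x : ℝ) - (Y.count x : ℝ))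

/-- The threshold `5 s² ε² / (8 |D|)` on the domain `D` on which the statistic is computed. -/
def threshold (D : Type) [Fintype D] (ε : ℝ) (s : ℕ) : ℝ :=
  5 * (s : ℝ) ^ 2 * ε ^ 2 / (8 * (Fintype.card D : ℝ))

/-- The possible outputs of the tester. -/
inductive Verdict : Type
  | accept
  | reject

open Classical in
/-- Reject exactly if the statistic reaches the threshold. -/
def verdict {D : Type} [Fintype D] [DecidableEq D] (ε : ℝ) (s : ℕ) (T Y : List D) : Verdict :=
  if threshold D ε s ≤ statistic T Y then Verdict.reject else Verdict.accept

/-- The closeness tester with flattening parameter `k` and `s` sources: draw `Poi(k)` samples from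
`q` for the flattening, then `Poi(s)` flattened samples from `q` and `Poi(1)` flattened samples
from each source. The result is the law of the output together with the total number of samples
drawn. -/
def tester {n s : ℕ} (ε k : ℝ) (q : PMF (Fin n)) (p : Fin s → PMF (Fin n)) : PMF (Verdict × ℕ) :=
  (poissonSamples k.toNNReal q).bind fun F =>
    (poissonSamples (s : ℝ≥0) (flatten F q)).bind fun Y =>
      (sourceSamples (List.ofFn fun i => flatten F (p i))).bind fun T =>
        PMF.pure (verdict ε s T Y, F.length + Y.length + T.length)

/-- The probability that the tester outputs `v` and draws at most `B` samples in total. -/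
def outputProb {n s : ℕ} (ε k : ℝ) (q : PMF (Fin n)) (p : Fin s → PMF (Fin n))
    (v : Verdict) (B : ℝ) : ℝ≥0∞ :=
  (tester ε k q p).toOuterMeasure {o | o.1 = v ∧ (o.2 : ℝ) ≤ B}

/-- The expected total number of samples drawn by the tester. -/
def expectedSamples {n s : ℕ} (ε k : ℝ) (q : PMF (Fin n)) (p : Fin s → PMF (Fin n)) : ℝ≥0∞ :=
  ∑' o : Verdict × ℕ, tester ε k q p o * (o.2 : ℝ≥0∞)

/-- The tester with parameters `k` and `s` is a correct closeness tester over `[n]` for the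
distance `ε`, with sample budget `B`: for all `q` and all sources, it draws at most `B` samples in
expectation; with probability at least `2/3` it accepts within the budget if all sources equal
`q`; and with probability at least `2/3` it rejects within the budget if all sources are `ε`-far
from `q` and satisfy the structural condition. -/
def TesterCorrect (n : ℕ) (ε k : ℝ) (s : ℕ) (B : ℝ) : Prop :=
  ∀ (q : PMF (Fin n)) (p : Fin s → PMF (Fin n)),
    ((∀ i, p i = q) → 2 / 3 ≤ outputProb ε k q p Verdict.accept B) ∧
    ((∀ i, ε ≤ l1Dist (p i) q) → StructuralCondition p q →
      2 / 3 ≤ outputProb ε k q p Verdict.reject B) ∧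
    expectedSamples ε k q p ≤ ENNReal.ofReal B

/-- The number of sources `s = ⌈c₁ n / (ε² √k)⌉`. -/
def numSources (c₁ : ℝ) (n : ℕ) (ε k : ℝ) : ℕ :=
  ⌈c₁ * (n : ℝ) / (ε ^ 2 * Real.sqrt k)⌉₊

/-- The choice `k = min (n, n^(2/3) / ε^(4/3))` of the flattening parameter. -/
def bestK (n : ℕ) (ε : ℝ) : ℝ :=
  min (n : ℝ) ((n : ℝ) ^ (2 / 3 : ℝ) / ε ^ (4 / 3 : ℝ))

end ClosenessTesting

end

/-! Poissonization makes the counts in the buckets independent Poisson variables. For independent T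
and Y with means μ and λ, (T-Y)²-T-Y has mean (μ-λ)² and variance 4(μ-λ)²(μ+λ)+2(μ+λ)². So Z has
mean E, the squared ℓ₂ distance between the summed source intensities and s times the flattened q.
Its variance is controlled by E and by L, which is s times the ℓ₂ norm of the flattened q, and
Chebyshev applies (`statistic_deviation`).

If all sources equal q, then E = 0. In the far case the structural condition rules out cancellation
between sources, so the ℓ₁ distance of the intensities is at least sε (`sum_abs_flatten`), and
Cauchy–Schwarz gives E ≥ s²ε²/|D|, which is 8/5 of the threshold (`mean_dominates`).

Flattening serves to make L small: k times the expected squared norm is at most 1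
(`mean_flatNormSq_le`), while |D| has mean n+k ≤ 2n. Markov's inequality controls both, and s of
order n/(ε²√k) then makes |D|L a small fraction of s²ε² (`parameters`). Two bad events for the
flattening, a wrong verdict and an exceeded budget cost 1/20+1/20+1/10+1/10 < 1/3 (`outputProb_ge`).

The Mecke identity `IsPoissonProcess` carries the Poisson part: it holds for Poissonized samples,
survives concatenation, determines the law of the counts (`IsPoissonProcess.counts_law`), and also
yields the flattening bound and the expected sample size. -/

/-! ### Expectations under discrete distributions -/

namespace PMF

variable {α β : Type}

/-- The expectation of a nonnegative function under a discrete distribution. -/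
noncomputable def mean (p : PMF α) (f : α → ℝ≥0∞) : ℝ≥0∞ := ∑' a, p a * f a

theorem mean_pure (a : α) (f : α → ℝ≥0∞) : (PMF.pure a).mean f = f a := by
  classical
  rw [mean, tsum_eq_single a]
  · simp
  · intro b hb
    simp [PMF.pure_apply, hb]

theorem mean_bind (p : PMF α) (k : α → PMF β) (f : β → ℝ≥0∞) :
    (p.bind k).mean f = p.mean fun a => (k a).mean f := by
  simp only [mean, PMF.bind_apply, ← ENNReal.tsum_mul_right, ← ENNReal.tsum_mul_left]
  rw [ENNReal.tsum_comm]
  simp only [mul_assoc]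

theorem mean_const (p : PMF α) (c : ℝ≥0∞) : (p.mean fun _ => c) = c := by
  rw [mean, ENNReal.tsum_mul_right, p.tsum_coe, one_mul]

theorem mean_add (p : PMF α) (f g : α → ℝ≥0∞) :
    (p.mean fun a => f a + g a) = p.mean f + p.mean g := by
  simp only [mean, mul_add, ENNReal.tsum_add]

theorem mean_mul_left (p : PMF α) (c : ℝ≥0∞) (f : α → ℝ≥0∞) :
    (p.mean fun a => c * f a) = c * p.mean f := by
  simp only [mean, ← ENNReal.tsum_mul_left]
  exact tsum_congr fun a => by ring

theorem mean_mul_right (p : PMF α) (c : ℝ≥0∞) (f : α → ℝ≥0∞) :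
    (p.mean fun a => f a * c) = p.mean f * c := by
  simp only [mul_comm _ c, mean_mul_left]

theorem mean_mono (p : PMF α) {f g : α → ℝ≥0∞} (h : ∀ a, f a ≤ g a) : p.mean f ≤ p.mean g :=
  ENNReal.tsum_le_tsum fun a => by gcongr; exact h a

theorem mean_le_one (p : PMF α) {f : α → ℝ≥0∞} (h : ∀ a, f a ≤ 1) : p.mean f ≤ 1 :=
  (p.mean_mono h).trans (p.mean_const 1).le

theorem mean_sum {ι : Type*} (p : PMF α) (t : Finset ι) (f : ι → α → ℝ≥0∞) :
    (p.mean fun a => ∑ i ∈ t, f i a) = ∑ i ∈ t, p.mean (f i) := by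
  classical
  induction t using Finset.induction_on with
  | empty => simp [mean_const]
  | insert i t hi ih => simp only [Finset.sum_insert hi, mean_add, ih]

theorem mean_comm (p : PMF α) (r : PMF β) (f : α → β → ℝ≥0∞) :
    (p.mean fun a => r.mean (f a)) = r.mean fun b => p.mean fun a => f a b := by
  simp only [mean, ← ENNReal.tsum_mul_left]
  rw [ENNReal.tsum_comm]
  exact tsum_congr fun b => tsum_congr fun a => by ring

open Classical in
theorem toOuterMeasure_eq_mean (p : PMF α) (S : Set α) :
    p.toOuterMeasure S = p.mean fun a => if a ∈ S then 1 else 0 := by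
  rw [PMF.toOuterMeasure_apply, mean]
  refine tsum_congr fun a => ?_
  by_cases h : a ∈ S <;> simp [h]

end PMF

/-! ### The Mecke identity for Poissonized samples -/

namespace ClosenessTesting

variable {α : Type} [DecidableEq α]

/-- The vector of the numbers of occurrences in a list. -/
def counts (l : List α) : α → ℕ := fun z => l.count z

theorem counts_cons (x : α) (l : List α) : counts (x :: l) = counts l + Pi.single x 1 := by
  funext z
  by_cases h : z = x
  · subst h; simp [counts]
  · simp [counts, h, Ne.symm h]

theorem counts_append (l m : List α) : counts (l ++ m) = counts l + counts m := by
  funext z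
  simp [counts]

/-- The Mecke identity, which characterizes the count vectors of a Poisson process with
intensity `lam`. -/
def IsPoissonProcess (P : PMF (List α)) (lam : α → ℝ≥0∞) : Prop :=
  ∀ (z : α) (g : (α → ℕ) → ℝ≥0∞),
    (P.mean fun l => (counts l z : ℝ≥0∞) * g (counts l)) =
      lam z * P.mean fun l => g (counts l + Pi.single z 1)

/-- Each of the m+1 positions holds z with probability `p z`, and deleting it leaves m independent
samples. The induction splits off the first sample x and applies the hypothesis to g shifted by x.
-/
theorem mean_iidSamples_succ (p : PMF α) (m : ℕ) (z : α) (g : (α → ℕ) → ℝ≥0∞) :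
    ((iidSamples p (m + 1)).mean fun l => (counts l z : ℝ≥0∞) * g (counts l)) =
      (m + 1 : ℕ) * p z * (iidSamples p m).mean fun l => g (counts l + Pi.single z 1) := by
  induction m generalizing g with
  | zero =>
    simp only [iidSamples, PMF.mean_bind, PMF.mean_pure, counts_cons]
    rw [PMF.mean, tsum_eq_single z]
    · simp [counts]
    · intro b hb
      simp [counts, hb.symm]
  | succ m ih =>
    have key : ∀ x, ((iidSamples p (m + 1)).mean fun l =>
        (counts (x :: l) z : ℝ≥0∞) * g (counts (x :: l))) =
        (m + 1 : ℕ) * p z * ((iidSamples p m).mean fun l =>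
          g (counts (x :: l) + Pi.single z 1)) +
        (if x = z then 1 else 0) * (iidSamples p (m + 1)).mean fun l =>
          g (counts l + Pi.single z 1) := by
      intro x
      have h1 := ih fun c => g (c + Pi.single x 1)
      simp only [counts_cons, add_right_comm _ (Pi.single x 1) (Pi.single z 1)]
      rw [← h1, ← PMF.mean_mul_left, ← PMF.mean_add]
      congr 1
      funext l
      by_cases h : x = z
      · subst h; simp [add_mul]
      · simp [h, Ne.symm h]
    have e1 : iidSamples p (m + 1 + 1) =
      p.bind fun x => (iidSamples p (m + 1)).bind fun xs => PMF.pure (x :: xs) := rfl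
    have e2 : iidSamples p (m + 1) =
      p.bind fun x => (iidSamples p m).bind fun xs => PMF.pure (x :: xs) := rfl
    rw [e1]
    simp only [PMF.mean_bind, PMF.mean_pure, key, PMF.mean_add, PMF.mean_mul_left,
      PMF.mean_mul_right]
    have e3 : (p.mean fun x => (iidSamples p m).mean fun l =>
        g (counts (x :: l) + Pi.single z 1)) =
        (iidSamples p (m + 1)).mean fun l => g (counts l + Pi.single z 1) := by
      rw [e2]
      simp only [PMF.mean_bind, PMF.mean_pure]
    have e4 : (p.mean fun x => if x = z then (1 : ℝ≥0∞) else 0) = p z := by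
      rw [PMF.mean, tsum_eq_single z]
      · simp
      · intro b hb
        simp [hb]
    rw [e3, e4]
    push_cast
    ring

theorem poissonMeasure_succ (r : ℝ≥0) (m : ℕ) :
    ProbabilityTheory.poissonMeasure r {m + 1} * (m + 1 : ℕ) =
      r * ProbabilityTheory.poissonMeasure r {m} := by
  rw [ProbabilityTheory.poissonMeasure_singleton, ProbabilityTheory.poissonMeasure_singleton,
    ← ENNReal.ofReal_natCast (m + 1), ← ENNReal.ofReal_coe_nnreal,
    ← ENNReal.ofReal_mul (by positivity), ← ENNReal.ofReal_mul (by positivity)]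
  congr 1
  rw [Nat.factorial_succ]
  push_cast
  field_simp
  ring

/-- The factor m+1 from `mean_iidSamples_succ` turns the Poisson weight of m+1 into r times that of
m. -/
theorem isPoissonProcess_poissonSamples (r : ℝ≥0) (p : PMF α) :
    IsPoissonProcess (poissonSamples r p) fun z => r * p z := by
  intro z g
  simp only [poissonSamples, PMF.mean_bind]
  rw [PMF.mean, tsum_eq_zero_add' ENNReal.summable]
  simp only [mean_iidSamples_succ, MeasureTheory.Measure.toPMF_apply]
  have h0 : ((iidSamples p 0).mean fun l => (counts l z : ℝ≥0∞) * g (counts l)) = 0 := by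
    simp [iidSamples, PMF.mean_pure, counts]
  rw [h0, mul_zero, zero_add, PMF.mean, ← ENNReal.tsum_mul_left]
  refine tsum_congr fun m => ?_
  rw [← mul_assoc, ← mul_assoc, poissonMeasure_succ, MeasureTheory.Measure.toPMF_apply]
  ring

/-- The count at z splits into two summands; each is treated by its own identity with the other list
held fixed. -/
theorem IsPoissonProcess.append {P Q : PMF (List α)} {lam mu : α → ℝ≥0∞}
    (hP : IsPoissonProcess P lam) (hQ : IsPoissonProcess Q mu) :
    IsPoissonProcess (P.bind fun xs => Q.bind fun ys => PMF.pure (xs ++ ys))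
      fun z => lam z + mu z := by
  intro z g
  simp only [PMF.mean_bind, PMF.mean_pure, counts_append, Pi.add_apply, Nat.cast_add, add_mul,
    PMF.mean_add]
  congr 1
  · rw [PMF.mean_comm, PMF.mean_comm P, ← PMF.mean_mul_left]
    congr 1
    funext l
    rw [hP z fun c => g (c + counts l)]
    simp only [add_right_comm]
  · rw [← PMF.mean_mul_left]
    congr 1
    funext l
    rw [hQ z fun c => g (counts l + c)]
    simp only [add_assoc]

theorem isPoissonProcess_sourceSamples (ps : List (PMF α)) :
    IsPoissonProcess (sourceSamples ps) fun z => (ps.map fun p => p z).sum := by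
  induction ps with
  | nil =>
    intro z g
    simp [sourceSamples, PMF.mean_pure, counts]
  | cons p ps ih =>
    have h := (isPoissonProcess_poissonSamples 1 p).append ih
    simpa [sourceSamples] using h

theorem length_eq_sum_counts [Fintype α] (l : List α) : l.length = ∑ z, counts l z := by
  induction l with
  | nil => simp [counts]
  | cons x l ih => simp [counts_cons, Finset.sum_add_distrib, ih]

theorem IsPoissonProcess.mean_length [Fintype α] {P : PMF (List α)} {lam : α → ℝ≥0∞}
    (hP : IsPoissonProcess P lam) : (P.mean fun l => (l.length : ℝ≥0∞)) = ∑ z, lam z := by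
  simp only [length_eq_sum_counts, Nat.cast_sum, PMF.mean_sum]
  refine Finset.sum_congr rfl fun z _ => ?_
  have h := hP z fun _ => 1
  simpa only [mul_one, PMF.mean_const] using h

end ClosenessTesting

/-! ### The counts are independent Poisson variables -/

namespace ClosenessTesting

open MeasureTheory ProbabilityTheory

/-- The probability of a count vector under independent Poisson counts. -/
noncomputable def poissonWeight {α : Type} [Fintype α] (lam : α → ℝ≥0) (c : α → ℕ) : ℝ≥0∞ :=
  ∏ z, poissonMeasure (lam z) {c z}

theorem poissonWeight_zero_ne_zero {α : Type} [Fintype α] (lam : α → ℝ≥0) : poissonWeight lam 0 ≠ 0 := by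
  refine Finset.prod_ne_zero_iff.2 fun z _ => ?_
  rw [poissonMeasure_singleton]
  simp [Real.exp_pos]

theorem tsum_poissonWeight {α : Type} [Fintype α] (lam : α → ℝ≥0) : ∑' c, poissonWeight lam c = 1 := by
  have h := (Measure.pi fun z => poissonMeasure (lam z)).toPMF.tsum_coe
  simpa only [Measure.toPMF_apply, Measure.pi_singleton, poissonWeight] using h

variable {α : Type} [DecidableEq α]

theorem IsPoissonProcess.counts_step [Fintype α] {P : PMF (List α)} {lam : α → ℝ≥0∞}
    (hP : IsPoissonProcess P lam) (c : α → ℕ) (z : α) :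
    ((c z + 1 : ℕ) : ℝ≥0∞) * (P.mean fun l => if counts l = c + Pi.single z 1 then 1 else 0) =
      lam z * P.mean fun l => if counts l = c then 1 else 0 := by
  have h := hP z fun d => if d = c + Pi.single z 1 then 1 else 0
  simp only [add_left_inj] at h
  rw [← h, ← PMF.mean_mul_left]
  congr 1
  funext l
  by_cases hl : counts l = c + Pi.single z 1
  · simp [hl]
  · simp [hl]

theorem poissonWeight_step [Fintype α] (lam : α → ℝ≥0) (c : α → ℕ) (z : α) :
    ((c z + 1 : ℕ) : ℝ≥0∞) * poissonWeight lam (c + Pi.single z 1) =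
      lam z * poissonWeight lam c := by
  have e : ∀ d : α → ℕ, poissonWeight lam d = poissonMeasure (lam z) {d z} *
      ∏ w ∈ Finset.univ.erase z, poissonMeasure (lam w) {d w} := fun d =>
    (Finset.mul_prod_erase Finset.univ (fun w => poissonMeasure (lam w) {d w})
      (Finset.mem_univ z)).symm
  rw [e c, e (c + Pi.single z 1), ← mul_assoc, ← mul_assoc, ← poissonMeasure_succ]
  have h1 : (c + Pi.single z 1 : α → ℕ) z = c z + 1 := by simp
  rw [h1, mul_comm (poissonMeasure (lam z) {c z + 1})]
  congr 1
  refine Finset.prod_congr rfl fun w hw => ?_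
  simp [Finset.ne_of_mem_erase hw]

/-- Both sides obey the same one-step recursion in every coordinate, so they are proportional; both
have total mass 1, so they agree. -/
theorem IsPoissonProcess.counts_law [Fintype α] {P : PMF (List α)} {lam : α → ℝ≥0}
    (hP : IsPoissonProcess P fun z => lam z) (c : α → ℕ) :
    (P.mean fun l => if counts l = c then 1 else 0) = poissonWeight lam c := by
  set f : (α → ℕ) → ℝ≥0∞ := fun c => P.mean fun l => if counts l = c then 1 else 0 with hf
  -- Proportionality in cross-multiplied form, by induction on the total count.
  have prop : ∀ m : ℕ, ∀ d : α → ℕ, ∑ z, d z = m →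
      f d * poissonWeight lam 0 = f 0 * poissonWeight lam d := by
    intro m
    induction m with
    | zero =>
      intro d hd
      have : d = 0 := by
        funext z
        exact Finset.sum_eq_zero_iff.1 hd z (Finset.mem_univ z)
      rw [this]
    | succ m ih =>
      intro d hd
      obtain ⟨z, hz⟩ : ∃ z, d z ≠ 0 := by
        by_contra! h
        simp [h] at hd
      obtain ⟨e, rfl⟩ : ∃ e : α → ℕ, d = e + Pi.single z 1 := by
        refine ⟨d - Pi.single z 1, ?_⟩
        funext w
        by_cases hw : w = z
        · subst hw; simp; omega
        · simp [hw]
      have he : ∑ z, e z = m := by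
        simpa [Finset.sum_add_distrib] using hd
      have h0 : ((e z + 1 : ℕ) : ℝ≥0∞) ≠ 0 := by simp
      rw [← ENNReal.mul_right_inj h0 (ENNReal.natCast_ne_top _), ← mul_assoc, hf]
      simp only
      rw [hP.counts_step e z, mul_assoc, mul_left_comm ((e z + 1 : ℕ) : ℝ≥0∞),
        poissonWeight_step, mul_left_comm _ (lam z : ℝ≥0∞)]
      congr 1
      exact ih e he
  have hsum : ∑' c, f c = 1 := by
    simp only [hf, PMF.mean]
    rw [ENNReal.tsum_comm]
    simp only [ENNReal.tsum_mul_left]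
    have : ∀ l : List α, ∑' c : α → ℕ, (if counts l = c then (1 : ℝ≥0∞) else 0) = 1 := fun l => by
      rw [tsum_eq_single (counts l)]
      · simp
      · intro b hb
        simp [hb.symm]
    simp only [this, mul_one, P.tsum_coe]
  have hzero : poissonWeight lam 0 = f 0 := by
    have h : ∑' d, f d * poissonWeight lam 0 = ∑' d, f 0 * poissonWeight lam d :=
      tsum_congr fun d => prop _ d rfl
    rwa [ENNReal.tsum_mul_right, ENNReal.tsum_mul_left, hsum, tsum_poissonWeight, one_mul,
      mul_one] at h
  have h := prop _ c rfl
  rw [← hzero, mul_comm] at h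
  refine (ENNReal.mul_right_inj (poissonWeight_zero_ne_zero lam) ?_).1 h
  refine ne_top_of_le_ne_top ENNReal.one_ne_top ?_
  exact (ENNReal.le_tsum 0).trans (tsum_poissonWeight lam).le

/-- The law of a Poisson process, in terms of the product of the laws of its counts. -/
theorem IsPoissonProcess.mean_eq_tsum [Fintype α] {P : PMF (List α)} {lam : α → ℝ≥0}
    (hP : IsPoissonProcess P fun z => lam z) (g : (α → ℕ) → ℝ≥0∞) :
    (P.mean fun l => g (counts l)) = ∑' c, poissonWeight lam c * g c := by
  simp only [← hP.counts_law, PMF.mean, ← ENNReal.tsum_mul_right]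
  rw [ENNReal.tsum_comm]
  refine tsum_congr fun l => ?_
  rw [tsum_eq_single (counts l)]
  · simp
  · intro b hb
    simp [hb.symm]

end ClosenessTesting

/-! ### Mean and variance of one term of the statistic -/

namespace ClosenessTesting

open MeasureTheory ProbabilityTheory

/-- The first a terms vanish, and shifting by a cancels the falling factorial, leaving `r ^ a` times
the total Poisson mass. -/
theorem hasSum_poisson_descFactorial (r : ℝ≥0) (a : ℕ) :
    HasSum (fun n : ℕ => Real.exp (-r) * (r : ℝ) ^ n / (n.factorial : ℝ) * (n.descFactorial a : ℝ))
      ((r : ℝ) ^ a) := by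
  have h := (hasSum_one_poissonMeasure r).mul_left ((r : ℝ) ^ a)
  rw [mul_one] at h
  rw [← hasSum_nat_add_iff' a]
  have h0 : ∑ i ∈ Finset.range a, Real.exp (-r) * (r : ℝ) ^ i / (i.factorial : ℝ) *
      (i.descFactorial a : ℝ) = 0 := by
    refine Finset.sum_eq_zero fun i hi => ?_
    rw [Nat.descFactorial_eq_zero_iff_lt.2 (Finset.mem_range.1 hi)]
    simp
  rw [h0, sub_zero]
  refine h.congr_fun fun n => ?_
  have h1 : ((n + a).descFactorial a : ℝ) * (n.factorial : ℝ) = ((n + a).factorial : ℝ) := by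
    have := Nat.factorial_mul_descFactorial (Nat.le_add_left a n)
    rw [Nat.add_sub_cancel] at this
    rw [← this]
    push_cast
    ring
  have h2 : (n.factorial : ℝ) ≠ 0 := by positivity
  have h3 : ((n + a).factorial : ℝ) ≠ 0 := by positivity
  rw [pow_add, eq_comm]
  field_simp
  rw [← h1]
  ring

theorem integrable_descFactorial (r : ℝ≥0) (a : ℕ) :
    Integrable (fun n : ℕ => (n.descFactorial a : ℝ)) (poissonMeasure r) := by
  rw [integrable_poissonMeasure_iff]
  simpa using (hasSum_poisson_descFactorial r a).summable

theorem integral_descFactorial (r : ℝ≥0) (a : ℕ) :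
    ∫ n : ℕ, (n.descFactorial a : ℝ) ∂(poissonMeasure r) = (r : ℝ) ^ a := by
  rw [integral_poissonMeasure]
  simpa using (hasSum_poisson_descFactorial r a).tsum_eq

/-- The contribution of one domain element to the statistic. -/
def term (x : ℕ × ℕ) : ℝ := ((x.1 : ℝ) - x.2) ^ 2 - x.1 - x.2

theorem descFactorial_two_cast (n : ℕ) : (n.descFactorial 2 : ℝ) = n * (n - 1) := by
  rcases n with _ | n
  · simp
  · simp [Nat.descFactorial]; ring

theorem descFactorial_three_cast (n : ℕ) : (n.descFactorial 3 : ℝ) = n * (n - 1) * (n - 2) := by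
  rcases n with _ | _ | n
  · simp
  · simp [Nat.descFactorial]
  · simp [Nat.descFactorial]; ring

theorem descFactorial_four_cast (n : ℕ) :
    (n.descFactorial 4 : ℝ) = n * (n - 1) * (n - 2) * (n - 3) := by
  rcases n with _ | _ | _ | n
  · simp
  · simp [Nat.descFactorial]
  · simp [Nat.descFactorial]
  · simp [Nat.descFactorial]; ring

/-- `f` is integrable with integral `v`. -/
def HasMean {Ω : Type*} [MeasurableSpace Ω] (m : Measure Ω) (f : Ω → ℝ) (v : ℝ) : Prop :=
  Integrable f m ∧ ∫ x, f x ∂m = v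

theorem HasMean.add {Ω : Type*} [MeasurableSpace Ω] {m : Measure Ω} {f g : Ω → ℝ} {v w : ℝ}
    (hf : HasMean m f v) (hg : HasMean m g w) : HasMean m (fun x => f x + g x) (v + w) :=
  ⟨hf.1.add hg.1, by rw [integral_add hf.1 hg.1, hf.2, hg.2]⟩

theorem HasMean.const_mul {Ω : Type*} [MeasurableSpace Ω] {m : Measure Ω} {f : Ω → ℝ} {v : ℝ}
    (c : ℝ) (hf : HasMean m f v) : HasMean m (fun x => c * f x) (c * v) :=
  ⟨hf.1.const_mul c, by rw [integral_const_mul, hf.2]⟩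

/-- Two independent Poisson variables. -/
noncomputable def poissonPair (mu lam : ℝ≥0) : Measure (ℕ × ℕ) := (poissonMeasure mu).prod (poissonMeasure lam)

instance (mu lam : ℝ≥0) : IsProbabilityMeasure (poissonPair mu lam) := by
  unfold poissonPair; infer_instance

theorem hasMean_descFactorial (mu lam : ℝ≥0) (a b : ℕ) :
    HasMean (poissonPair mu lam)
      (fun x => (x.1.descFactorial a : ℝ) * (x.2.descFactorial b : ℝ))
      ((mu : ℝ) ^ a * (lam : ℝ) ^ b) := by
  refine ⟨(integrable_descFactorial mu a).mul_prod (integrable_descFactorial lam b), ?_⟩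
  rw [poissonPair, integral_prod_mul (fun n : ℕ => (n.descFactorial a : ℝ))
    (fun n : ℕ => (n.descFactorial b : ℝ)), integral_descFactorial, integral_descFactorial]

/-- Subtracting both counts turns the squares into falling factorials: x(x-1) + y(y-1) - 2xy. -/
theorem hasMean_term (mu lam : ℝ≥0) :
    HasMean (poissonPair mu lam) term (((mu : ℝ) - lam) ^ 2) := by
  have H := hasMean_descFactorial mu lam
  convert! ((H 2 0).add (H 0 2)).add ((H 1 1).const_mul (-2)) using 1
  · funext x
    simp only [term, descFactorial_two_cast, Nat.descFactorial_zero, Nat.descFactorial_one]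
    push_cast
    ring
  · ring

/-- The coefficients are those of `term x ^ 2` in products of falling factorials. The value is
written as squared mean plus variance. -/
theorem hasMean_term_sq (mu lam : ℝ≥0) :
    HasMean (poissonPair mu lam) (fun x => term x ^ 2)
      ((((mu : ℝ) - lam) ^ 2) ^ 2 + (4 * ((mu : ℝ) - lam) ^ 2 * (mu + lam) +
        2 * ((mu : ℝ) + lam) ^ 2)) := by
  have H := hasMean_descFactorial mu lam
  convert! (((((H 4 0).add ((H 3 0).const_mul 4)).add ((H 2 0).const_mul 2)).add
    (((H 0 4).add ((H 0 3).const_mul 4)).add ((H 0 2).const_mul 2))).add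
    ((((((H 2 2).const_mul 6).add ((H 2 1).const_mul (-4))).add ((H 1 2).const_mul (-4))).add
    ((H 1 1).const_mul 4)).add (((H 3 1).const_mul (-4)).add ((H 1 3).const_mul (-4))))) using 1
  · funext x
    simp only [term, descFactorial_two_cast, descFactorial_three_cast, descFactorial_four_cast,
      Nat.descFactorial_zero, Nat.descFactorial_one]
    push_cast
    ring
  · ring

theorem memLp_term (mu lam : ℝ≥0) : MemLp term 2 (poissonPair mu lam) :=
  (memLp_two_iff_integrable_sq (hasMean_term mu lam).1.aestronglyMeasurable).2
    (hasMean_term_sq mu lam).1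

theorem variance_term (mu lam : ℝ≥0) :
    variance term (poissonPair mu lam) =
      4 * ((mu : ℝ) - lam) ^ 2 * (mu + lam) + 2 * ((mu : ℝ) + lam) ^ 2 := by
  rw [variance_eq_sub (memLp_term mu lam), (hasMean_term mu lam).2]
  have := (hasMean_term_sq mu lam).2
  simp only [Pi.pow_apply]
  rw [this]
  ring

end ClosenessTesting

/-! ### Chebyshev's inequality for the statistic -/

namespace ClosenessTesting

open MeasureTheory ProbabilityTheory

/-- Passes from iterated sums over two count vectors to a product over z of pair laws, where the
terms of the statistic are independent. -/
theorem tsum_poissonWeight_mul {α : Type} [Fintype α] (mu lam : α → ℝ≥0)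
    (S : Set (α → ℕ × ℕ)) [DecidablePred (· ∈ S)] :
    ∑' b, poissonWeight lam b * ∑' a, poissonWeight mu a *
      (if (fun z => (a z, b z)) ∈ S then 1 else 0) =
      Measure.pi (fun z => poissonPair (mu z) (lam z)) S := by
  rw [← Measure.tsum_indicator_apply_singleton _ S (.of_discrete),
    ← (Equiv.arrowProdEquivProdArrow α (fun _ => ℕ) (fun _ => ℕ)).symm.tsum_eq,
    ENNReal.tsum_prod', ENNReal.tsum_comm]
  refine tsum_congr fun b => ?_
  rw [← ENNReal.tsum_mul_left]
  refine tsum_congr fun a => ?_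
  by_cases h : (fun z => (a z, b z)) ∈ S
  · have h' : (Equiv.arrowProdEquivProdArrow α (fun _ => ℕ) (fun _ => ℕ)).symm (a, b) ∈ S := h
    rw [Set.indicator_of_mem h', if_pos h, Measure.pi_singleton, mul_one, poissonWeight,
      poissonWeight, ← Finset.prod_mul_distrib]
    refine Finset.prod_congr rfl fun z _ => ?_
    have : ({((Equiv.arrowProdEquivProdArrow α (fun _ => ℕ) (fun _ => ℕ)).symm (a, b)) z} :
      Set (ℕ × ℕ)) = {a z} ×ˢ {b z} := by
      rw [Set.singleton_prod_singleton]; rfl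
    rw [this, poissonPair, Measure.prod_prod, mul_comm]
  · have h' : (Equiv.arrowProdEquivProdArrow α (fun _ => ℕ) (fun _ => ℕ)).symm (a, b) ∉ S := h
    rw [Set.indicator_of_notMem h', if_neg h, mul_zero, mul_zero]

variable {α : Type} [DecidableEq α] [Fintype α]

theorem statistic_eq_sum_term (T Y : List α) :
    statistic T Y = ∑ z, term (counts T z, counts Y z) := rfl

open Classical in
/-- Chebyshev's inequality for the statistic. -/
theorem statistic_deviation {P Q : PMF (List α)} {mu lam : α → ℝ≥0}
    (hP : IsPoissonProcess P fun z => mu z) (hQ : IsPoissonProcess Q fun z => lam z)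
    {t : ℝ} (ht : 0 < t) :
    (Q.mean fun Y => P.mean fun T =>
      if t ≤ |statistic T Y - ∑ z, ((mu z : ℝ) - lam z) ^ 2| then 1 else 0) ≤
    ENNReal.ofReal ((∑ z, (4 * ((mu z : ℝ) - lam z) ^ 2 * (mu z + lam z) +
        2 * ((mu z : ℝ) + lam z) ^ 2)) / t ^ 2) := by
  set m := Measure.pi (fun z => poissonPair (mu z) (lam z)) with hm
  set X : (α → ℕ × ℕ) → ℝ := ∑ z, fun c => term (c z) with hX
  have hmem : ∀ z, MemLp (fun c : α → ℕ × ℕ => term (c z)) 2 m := fun z =>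
    (memLp_term (mu z) (lam z)).comp_measurePreserving (measurePreserving_eval _ z)
  have hXmem : MemLp X 2 m := memLp_finsetSum' _ fun z _ => hmem z
  have hmean : ∫ c, X c ∂m = ∑ z, ((mu z : ℝ) - lam z) ^ 2 := by
    simp only [hX, Finset.sum_apply]
    rw [integral_finsetSum _ fun z _ => (hmem z).integrable (by norm_num)]
    refine Finset.sum_congr rfl fun z _ => ?_
    rw [← (hasMean_term (mu z) (lam z)).2]
    exact integral_comp_eval (hasMean_term (mu z) (lam z)).1.aestronglyMeasurable
  have hvar : variance X m = ∑ z, (4 * ((mu z : ℝ) - lam z) ^ 2 * (mu z + lam z) +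
        2 * ((mu z : ℝ) + lam z) ^ 2) := by
    rw [hX, hm, variance_sum_pi fun z => memLp_term (mu z) (lam z)]
    exact Finset.sum_congr rfl fun z _ => variance_term _ _
  have hcheb := meas_ge_le_variance_div_sq hXmem ht
  rw [hmean, hvar] at hcheb
  refine le_trans (le_of_eq ?_) hcheb
  rw [hm, ← tsum_poissonWeight_mul mu lam]
  set S : Set (α → ℕ × ℕ) := {c | t ≤ |X c - ∑ z, ((mu z : ℝ) - lam z) ^ 2|} with hS
  have hg : ∀ T Y : List α,
      (if t ≤ |statistic T Y - ∑ z, ((mu z : ℝ) - lam z) ^ 2| then (1 : ℝ≥0∞) else 0) =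
        if (fun z => (counts T z, counts Y z)) ∈ S then 1 else 0 := fun T Y =>
    if_congr (by simp [hS, hX, statistic_eq_sum_term]) rfl rfl
  simp only [hg]
  have h1 := fun Y : List α => hP.mean_eq_tsum fun a =>
    if (fun z => (a z, counts Y z)) ∈ S then (1 : ℝ≥0∞) else 0
  simp only [h1]
  exact hQ.mean_eq_tsum fun b => ∑' a, poissonWeight mu a *
      if (fun z => (a z, b z)) ∈ S then 1 else 0

end ClosenessTesting

/-! ### Numerical estimates and the choice of constants -/

namespace ClosenessTesting

/-- With δ = mu - lam one has mu + lam = δ + 2 lam, which is at most D + 2L, and its square is at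
most 2δ² + 8 lam². -/
theorem variance_term_le {mu lam L D : ℝ} (hL : lam ≤ L)
    (hD : |mu - lam| ≤ D) :
    4 * (mu - lam) ^ 2 * (mu + lam) + 2 * (mu + lam) ^ 2 ≤
      (8 * L + 4 * D + 4) * (mu - lam) ^ 2 + 16 * lam ^ 2 := by
  have h1 : mu - lam ≤ D := (le_abs_self _).trans hD
  have h2 : 0 ≤ (mu - lam) ^ 2 := sq_nonneg _
  nlinarith [mul_nonneg h2 (sub_nonneg.2 hL), mul_nonneg h2 (sub_nonneg.2 h1),
    sq_nonneg (mu - 3 * lam)]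

/-- The reject side: the mean dominates the threshold and the standard deviation. -/
theorem mean_dominates {α : Type} [Fintype α] [Nonempty α] (mu lam : α → ℝ) (A a L : ℝ)
    (hL0 : 0 ≤ L) (hL : ∑ z, lam z ^ 2 = L ^ 2)
    (hA : A = a ^ 2) (ha : 0 < a) (hl1 : a ≤ ∑ z, |mu z - lam z|)
    (h1 : (Fintype.card α : ℝ) * L ≤ 21 / 20000 * A)
    (h2 : (Fintype.card α : ℝ) * 10 ^ 8 ≤ A) :
    0 < ∑ z, (mu z - lam z) ^ 2 ∧
    5 * A / (8 * (Fintype.card α : ℝ)) ≤ 5 / 8 * ∑ z, (mu z - lam z) ^ 2 ∧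
    (∑ z, (4 * (mu z - lam z) ^ 2 * (mu z + lam z) + 2 * (mu z + lam z) ^ 2)) /
      (3 / 8 * ∑ z, (mu z - lam z) ^ 2) ^ 2 ≤ 1 / 10 := by
  set E := ∑ z, (mu z - lam z) ^ 2 with hE
  set d : ℝ := (Fintype.card α : ℝ) with hd
  have hd0 : 0 < d := by
    rw [hd]
    exact_mod_cast Fintype.card_pos
  have hCS : A ≤ d * E := by
    -- Cauchy–Schwarz turns the ℓ₁ lower bound into an ℓ₂ one.
    have h := sq_sum_le_card_mul_sum_sq (s := Finset.univ) (f := fun z => |mu z - lam z|)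
    simp only [sq_abs, Finset.card_univ] at h
    rw [hA]
    exact (pow_le_pow_left₀ ha.le hl1 2).trans h
  have hLE : L ≤ 21 / 20000 * E := by
    refine le_of_mul_le_mul_left ?_ hd0
    linarith
  have hE8 : 10 ^ 8 ≤ E := by
    refine le_of_mul_le_mul_left ?_ hd0
    linarith
  have hE0 : 0 < E := by linarith
  refine ⟨hE0, ?_, ?_⟩
  · rw [div_le_iff₀ (by positivity)]
    linarith
  have hlamL : ∀ z, lam z ≤ L := fun z => by
    refine le_of_sq_le_sq ?_ hL0
    rw [← hL]
    exact Finset.single_le_sum (f := fun z => lam z ^ 2) (fun _ _ => sq_nonneg _)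
      (Finset.mem_univ z)
  have hD : ∀ z, |mu z - lam z| ≤ Real.sqrt E := fun z => by
    refine Real.abs_le_sqrt ?_
    exact Finset.single_le_sum (f := fun z => (mu z - lam z) ^ 2) (fun _ _ => sq_nonneg _)
      (Finset.mem_univ z)
  have hsq : Real.sqrt E ^ 2 = E := Real.sq_sqrt hE0.le
  have hsE : Real.sqrt E * 10 ^ 4 ≤ E := by
    have h4 : (10 : ℝ) ^ 4 ≤ Real.sqrt E := Real.le_sqrt_of_sq_le (by norm_num; linarith)
    nlinarith [Real.sqrt_nonneg E]
  have hV : (∑ z, (4 * (mu z - lam z) ^ 2 * (mu z + lam z) + 2 * (mu z + lam z) ^ 2)) ≤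
      (8 * L + 4 * Real.sqrt E + 4) * E + 16 * L ^ 2 := by
    refine (Finset.sum_le_sum fun z _ => variance_term_le (hlamL z) (hD z)).trans ?_
    rw [Finset.sum_add_distrib, ← Finset.mul_sum, ← Finset.mul_sum, hL]
  rw [div_le_iff₀ (by positivity)]
  -- The summands are at most 0.0084 E, 0.0004 E and 4·10⁻⁸ E. With 16 L², the total stays below the
  -- allowed (9/640) E².
  have h5 : (8 * L + 4 * Real.sqrt E + 4) * E ≤ (9 / 1000 * E) * E := by
    gcongr
    linarith
  have h6 : L ^ 2 ≤ (21 / 20000 * E) ^ 2 := by gcongr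
  nlinarith

/-- The accept side: for equal intensities the variance is 8 L², compared here with the squared
threshold. -/
theorem variance_equal_le {d A L : ℝ} (hd : 0 < d) (hA : 0 < A) (hL0 : 0 ≤ L)
    (h1 : d * L ≤ 21 / 20000 * A) :
    8 * L ^ 2 / (5 * A / (8 * d)) ^ 2 ≤ 1 / 10 := by
  have h2 : (d * L) ^ 2 ≤ (21 / 20000 * A) ^ 2 := by gcongr
  rw [div_pow, div_div_eq_mul_div, div_le_iff₀ (by positivity)]
  nlinarith [sq_nonneg A]

/-- The parameters of the tester make the flattened norm and the domain small. -/
theorem parameters {n s ε k d w : ℝ} (hn : 1 ≤ n) (hε : 0 < ε) (hε2 : ε ≤ 2)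
    (hk : 0 < k) (hkn : k ≤ n) (hs : 10 ^ 5 * n / (ε ^ 2 * Real.sqrt k) ≤ s)
    (hw0 : 0 ≤ w) (hw : k * w ^ 2 ≤ 20) (hd : d ≤ 21 * n) :
    d * (s * w) ≤ 21 / 20000 * (s ^ 2 * ε ^ 2) ∧ d * 10 ^ 8 ≤ s ^ 2 * ε ^ 2 := by
  have hR : 0 < Real.sqrt k := Real.sqrt_pos.2 hk
  have hRk : Real.sqrt k ^ 2 = k := Real.sq_sqrt hk.le
  rw [div_le_iff₀ (by positivity)] at hs
  set R := Real.sqrt k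
  have hs0 : 0 < s := by
    by_contra h
    have : s * (ε ^ 2 * R) ≤ 0 := mul_nonpos_of_nonpos_of_nonneg (not_lt.1 h) (by positivity)
    linarith
  have hRw : R * w ≤ 5 := by
    refine le_of_sq_le_sq ?_ (by norm_num)
    rw [mul_pow, hRk]
    linarith
  constructor
  · have h1 : n * w * 10 ^ 5 ≤ 5 * (s * ε ^ 2) := by
      calc n * w * 10 ^ 5 = 10 ^ 5 * n * w := by ring
        _ ≤ s * (ε ^ 2 * R) * w := by gcongr
        _ = s * ε ^ 2 * (R * w) := by ring
        _ ≤ s * ε ^ 2 * 5 := by gcongr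
        _ = _ := by ring
    have h2 : d * w ≤ 21 * n * w := by gcongr
    calc d * (s * w) = s * (d * w) := by ring
      _ ≤ s * (21 / 20000 * (s * ε ^ 2)) := mul_le_mul_of_nonneg_left (by linarith) hs0.le
      _ = _ := by ring
  · have h1 : (10 ^ 5 * n) ^ 2 ≤ (s * (ε ^ 2 * R)) ^ 2 := by gcongr
    have h2 : (s * (ε ^ 2 * R)) ^ 2 ≤ s ^ 2 * ε ^ 2 * 4 * n := by
      calc (s * (ε ^ 2 * R)) ^ 2 = s ^ 2 * ε ^ 2 * ε ^ 2 * k := by rw [← hRk]; ring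
        _ ≤ s ^ 2 * ε ^ 2 * 2 ^ 2 * n := by gcongr
        _ = _ := by ring
    have h3 : n * 10 ^ 10 ≤ s ^ 2 * ε ^ 2 * 4 := by
      refine le_of_mul_le_mul_right ?_ (by linarith : 0 < n)
      calc n * 10 ^ 10 * n = (10 ^ 5 * n) ^ 2 := by ring
        _ ≤ _ := h1.trans h2
    linarith

theorem numSources_le {n : ℕ} {ε k : ℝ} (hn : 1 ≤ n) (hε : 0 < ε) (hε2 : ε ≤ 2)
    (hk : 0 < k) (hkn : k ≤ n) :
    (numSources (10 ^ 5) n ε k : ℝ) ≤ (10 ^ 5 + 4) * (n / (ε ^ 2 * Real.sqrt k)) := by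
  have hn' : (1 : ℝ) ≤ n := by exact_mod_cast hn
  have hR : 0 < Real.sqrt k := Real.sqrt_pos.2 hk
  -- The one lost to the ceiling is absorbed into the main term, since ε² ≤ 4 and √k ≤ n.
  have h1 : 1 ≤ 4 * (n / (ε ^ 2 * Real.sqrt k)) := by
    rw [← mul_div_assoc, le_div_iff₀ (by positivity), one_mul]
    have h2 : Real.sqrt k ≤ n := by
      rw [Real.sqrt_le_left (by positivity)]
      nlinarith
    calc ε ^ 2 * Real.sqrt k ≤ 2 ^ 2 * n := by gcongr
      _ = _ := by norm_num
  have h2 := Nat.ceil_lt_add_one (a := 10 ^ 5 * (n : ℝ) / (ε ^ 2 * Real.sqrt k)) (by positivity)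
  rw [numSources]
  rw [mul_div_assoc] at h2 ⊢
  linarith

theorem bestK_pos {n : ℕ} {ε : ℝ} (hn : 1 ≤ n) (hε : 0 < ε) : 0 < bestK n ε := by
  have : (0 : ℝ) < n := by exact_mod_cast hn
  exact lt_min this (by positivity)

/-- At k = n^(2/3)/ε^(4/3) the two costs balance exactly; at k = n the second one is √n/ε². -/
theorem bestK_cost {n : ℕ} {ε : ℝ} (hn : 1 ≤ n) (hε : 0 < ε) :
    bestK n ε + n / (ε ^ 2 * Real.sqrt (bestK n ε)) ≤
      2 * ((n : ℝ) ^ (2 / 3 : ℝ) / ε ^ (4 / 3 : ℝ) + Real.sqrt n / ε ^ 2) := by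
  have hn0 : (0 : ℝ) < n := by exact_mod_cast hn
  have hm0 : 0 < (n : ℝ) ^ (2 / 3 : ℝ) / ε ^ (4 / 3 : ℝ) := by positivity
  have hk0 := bestK_pos hn hε
  have hle : bestK n ε ≤ (n : ℝ) ^ (2 / 3 : ℝ) / ε ^ (4 / 3 : ℝ) := min_le_right _ _
  have hsq0 : 0 ≤ Real.sqrt n / ε ^ 2 := by positivity
  rcases min_choice (n : ℝ) ((n : ℝ) ^ (2 / 3 : ℝ) / ε ^ (4 / 3 : ℝ)) with h | h
  · have hb : bestK n ε = n := h
    have h1 : (n : ℝ) / (ε ^ 2 * Real.sqrt n) = Real.sqrt n / ε ^ 2 := by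
      have : Real.sqrt n * Real.sqrt n = n := Real.mul_self_sqrt hn0.le
      rw [div_eq_div_iff (by positivity) (by positivity)]
      linear_combination (-ε ^ 2) * this
    rw [hb] at hle ⊢
    rw [h1]
    linarith
  · have hb : bestK n ε = (n : ℝ) ^ (2 / 3 : ℝ) / ε ^ (4 / 3 : ℝ) := h
    have h1 : (n : ℝ) / (ε ^ 2 * Real.sqrt ((n : ℝ) ^ (2 / 3 : ℝ) / ε ^ (4 / 3 : ℝ))) =
        (n : ℝ) ^ (2 / 3 : ℝ) / ε ^ (4 / 3 : ℝ) := by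
      rw [Real.sqrt_eq_rpow, Real.div_rpow (by positivity) (by positivity), ← Real.rpow_mul hn0.le,
        ← Real.rpow_mul hε.le]
      norm_num
      rw [div_eq_div_iff (by positivity) (by positivity)]
      have e1 : (n : ℝ) = (n : ℝ) ^ (2 / 3 : ℝ) * (n : ℝ) ^ (1 / 3 : ℝ) := by
        rw [← Real.rpow_add hn0]; norm_num
      have e2 : ε ^ 2 = ε ^ (4 / 3 : ℝ) * ε ^ (2 / 3 : ℝ) := by
        rw [← Real.rpow_add hε]; norm_num
      have e3 : (0 : ℝ) < ε ^ (2 / 3 : ℝ) := by positivity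
      conv_lhs => rw [e1]
      rw [e2]
      field_simp
    rw [hb, h1]
    linarith

end ClosenessTesting

/-! ### Verdicts for a fixed flattening, and the effect of flattening -/

namespace ClosenessTesting

section Verdicts

variable {α : Type} [DecidableEq α] [Fintype α] [Nonempty α]

-- The statistic has mean 0 here, so a rejection is a deviation by at least the threshold.
open Classical in
theorem accept_of_equal {P Q : PMF (List α)} {lam : α → ℝ≥0}
    (hP : IsPoissonProcess P fun z => lam z) (hQ : IsPoissonProcess Q fun z => lam z)
    {ε L : ℝ} {s : ℕ} (hA : 0 < (s : ℝ) ^ 2 * ε ^ 2) (hL0 : 0 ≤ L)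
    (hL : ∑ z, (lam z : ℝ) ^ 2 = L ^ 2)
    (h1 : (Fintype.card α : ℝ) * L ≤ 21 / 20000 * ((s : ℝ) ^ 2 * ε ^ 2)) :
    (Q.mean fun Y => P.mean fun T => if verdict ε s T Y ≠ Verdict.accept then 1 else 0) ≤
      ENNReal.ofReal (1 / 10) := by
  have hd : (0 : ℝ) < Fintype.card α := by exact_mod_cast Fintype.card_pos
  have ht : 0 < threshold α ε s := by
    rw [threshold, mul_assoc]
    positivity
  refine le_trans (PMF.mean_mono _ fun Y => PMF.mean_mono _ fun T => ?_)
    ((statistic_deviation hP hQ ht).trans (ENNReal.ofReal_le_ofReal ?_))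
  · by_cases h : threshold α ε s ≤ statistic T Y
    · have h' : threshold α ε s ≤
          |statistic T Y - ∑ z, ((lam z : ℝ) - lam z) ^ 2| := by
        simpa using h.trans (le_abs_self _)
      rw [if_pos h']
      split_ifs <;> simp
    · simp [verdict, h]
  · have e : ∑ z, (4 * ((lam z : ℝ) - lam z) ^ 2 * (lam z + lam z) +
        2 * ((lam z : ℝ) + lam z) ^ 2) = 8 * L ^ 2 := by
      rw [← hL, Finset.mul_sum]
      exact Finset.sum_congr rfl fun z _ => by ring
    rw [e, threshold, mul_assoc 5]
    exact variance_equal_le hd hA hL0 h1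

-- The threshold is at most 5/8 of the mean E, so an acceptance is a deviation by at least 3/8 E.
open Classical in
theorem reject_of_far {P Q : PMF (List α)} {mu lam : α → ℝ≥0}
    (hP : IsPoissonProcess P fun z => mu z) (hQ : IsPoissonProcess Q fun z => lam z)
    {ε L : ℝ} {s : ℕ} (hA : 0 < (s : ℝ) * ε) (hL0 : 0 ≤ L)
    (hL : ∑ z, (lam z : ℝ) ^ 2 = L ^ 2)
    (hfar : (s : ℝ) * ε ≤ ∑ z, |(mu z : ℝ) - lam z|)
    (h1 : (Fintype.card α : ℝ) * L ≤ 21 / 20000 * ((s : ℝ) ^ 2 * ε ^ 2))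
    (h2 : (Fintype.card α : ℝ) * 10 ^ 8 ≤ (s : ℝ) ^ 2 * ε ^ 2) :
    (Q.mean fun Y => P.mean fun T => if verdict ε s T Y ≠ Verdict.reject then 1 else 0) ≤
      ENNReal.ofReal (1 / 10) := by
  obtain ⟨hE, hthr, hvar⟩ := mean_dominates (fun z => (mu z : ℝ)) (fun z => (lam z : ℝ))
    ((s : ℝ) ^ 2 * ε ^ 2) (s * ε) L hL0 hL (by ring) hA hfar h1 h2
  rw [← mul_assoc, ← threshold] at hthr
  set E := ∑ z, ((mu z : ℝ) - lam z) ^ 2 with hEdef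
  refine le_trans (PMF.mean_mono _ fun Y => PMF.mean_mono _ fun T => ?_)
    ((statistic_deviation hP hQ (t := 3 / 8 * E) (by positivity)).trans
      (ENNReal.ofReal_le_ofReal hvar))
  by_cases h : threshold α ε s ≤ statistic T Y
  · simp [verdict, h]
  · have h' : 3 / 8 * E ≤ |statistic T Y - ∑ z, ((mu z : ℝ) - lam z) ^ 2| := by
      rw [abs_sub_comm]
      refine le_trans ?_ (le_abs_self _)
      rw [← hEdef]
      linarith
    rw [if_pos h']
    split_ifs <;> simp

end Verdicts

section Flattening

variable {n : ℕ}

theorem flatten_apply (F : List (Fin n)) (p : PMF (Fin n)) (x : Fin n)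
    (y : Fin (buckets F x)) : flatten F p ⟨x, y⟩ = p x * (buckets F x : ℝ≥0∞)⁻¹ := by
  rw [flatten, PMF.bind_apply, tsum_eq_single x]
  · rw [PMF.bind_apply, tsum_eq_single y]
    · simp [PMF.uniformOfFintype_apply]
    · intro b hb
      simp [PMF.pure_apply, hb.symm]
  · intro b hb
    rw [PMF.bind_apply, ENNReal.tsum_eq_zero.2, mul_zero]
    intro c
    simp [PMF.pure_apply, hb.symm]

theorem card_flatDomain (F : List (Fin n)) : Fintype.card (FlatDomain F) = F.length + n := by
  rw [Fintype.card_sigma, length_eq_sum_counts]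
  calc _ = ∑ x, (counts F x + 1) := Finset.sum_congr rfl fun x _ => Fintype.card_fin _
    _ = _ := by simp [Finset.sum_add_distrib]

theorem sum_buckets (F : List (Fin n)) (x : Fin n) (c : ℝ) :
    ∑ _y : Fin (buckets F x), c * (buckets F x : ℝ)⁻¹ = c := by
  have : (buckets F x : ℝ) ≠ 0 := by simp [buckets]; positivity
  rw [Finset.sum_const, Finset.card_univ, Fintype.card_fin, nsmul_eq_mul]
  field_simp

theorem flatten_toReal (F : List (Fin n)) (p : PMF (Fin n)) (x : Fin n)
    (y : Fin (buckets F x)) :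
    (flatten F p ⟨x, y⟩).toReal = (p x).toReal * (buckets F x : ℝ)⁻¹ := by
  rw [flatten_apply, ENNReal.toReal_mul, ENNReal.toReal_inv, ENNReal.toReal_natCast]

/-- Under the structural condition the differences of the sources add up without cancellation. -/
theorem sum_abs_flatten {s : ℕ} (F : List (Fin n)) (q : PMF (Fin n)) (p : Fin s → PMF (Fin n))
    {ε : ℝ} (hfar : ∀ i, ε ≤ l1Dist (p i) q) (hst : StructuralCondition p q) :
    s * ε ≤ ∑ z, |(∑ i, (flatten F (p i) z).toReal) - s * (flatten F q z).toReal| := by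
  obtain ⟨A, hA⟩ := hst
  -- At each x all differences have the same sign, determined by membership in A.
  have hx : ∀ x, |∑ i, ((p i x).toReal - (q x).toReal)| = ∑ i, |(p i x).toReal - (q x).toReal| := by
    intro x
    by_cases hxA : x ∈ A
    · have h : ∀ i, 0 ≤ (p i x).toReal - (q x).toReal := fun i =>
        sub_nonneg.2 (ENNReal.toReal_mono ((p i).apply_ne_top x) ((hA i).1 x hxA))
      rw [abs_of_nonneg (Finset.sum_nonneg fun i _ => h i)]
      exact Finset.sum_congr rfl fun i _ => (abs_of_nonneg (h i)).symm
    · have h : ∀ i, (p i x).toReal - (q x).toReal ≤ 0 := fun i =>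
        sub_nonpos.2 (ENNReal.toReal_mono (q.apply_ne_top x) ((hA i).2 x hxA))
      rw [abs_of_nonpos (Finset.sum_nonpos fun i _ => h i), ← Finset.sum_neg_distrib]
      exact Finset.sum_congr rfl fun i _ => (abs_of_nonpos (h i)).symm
  have hz : ∀ (x : Fin n) (y : Fin (buckets F x)),
      |(∑ i, (flatten F (p i) ⟨x, y⟩).toReal) - s * (flatten F q ⟨x, y⟩).toReal| =
        (∑ i, |(p i x).toReal - (q x).toReal|) * (buckets F x : ℝ)⁻¹ := by
    intro x y
    rw [← hx, ← abs_of_nonneg (inv_nonneg.2 (Nat.cast_nonneg (buckets F x)) : (0 : ℝ) ≤ _),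
      ← abs_mul]
    simp only [flatten_toReal]
    rw [← Finset.sum_mul, Finset.sum_sub_distrib, Finset.sum_const, Finset.card_univ,
      Fintype.card_fin, nsmul_eq_mul]
    congr 1
    ring
  rw [Fintype.sum_sigma]
  simp only [hz, sum_buckets]
  rw [Finset.sum_comm]
  calc (s : ℝ) * ε = ∑ _i : Fin s, ε := by simp
    _ ≤ _ := Finset.sum_le_sum fun i _ => hfar i

/-- The squared `ℓ₂`-norm of the flattened distribution. -/
noncomputable def flatNormSq (F : List (Fin n)) (q : PMF (Fin n)) : ℝ≥0∞ :=
  ∑ z, flatten F q z ^ 2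

theorem flatNormSq_eq (F : List (Fin n)) (q : PMF (Fin n)) :
    flatNormSq F q = ∑ x, q x * (q x * ((counts F x + 1 : ℕ) : ℝ≥0∞)⁻¹) := by
  rw [flatNormSq, Fintype.sum_sigma]
  refine Finset.sum_congr rfl fun x _ => ?_
  simp only [flatten_apply]
  rw [Finset.sum_const, Finset.card_univ, Fintype.card_fin, nsmul_eq_mul]
  have hb : (counts F x + 1 : ℕ) = buckets F x := rfl
  rw [hb]
  have h0 : (buckets F x : ℝ≥0∞) ≠ 0 := by simp [buckets]
  have h1 : (buckets F x : ℝ≥0∞) * (buckets F x : ℝ≥0∞)⁻¹ = 1 :=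
    ENNReal.mul_inv_cancel h0 (ENNReal.natCast_ne_top _)
  calc (buckets F x : ℝ≥0∞) * (q x * (buckets F x : ℝ≥0∞)⁻¹) ^ 2
      = (buckets F x : ℝ≥0∞) * (buckets F x : ℝ≥0∞)⁻¹ * (q x * (q x * (buckets F x : ℝ≥0∞)⁻¹)) := by
        ring
    _ = _ := by rw [h1, one_mul]

/-- Flattening with `Poi(r)` samples brings the expected squared norm down to `1 / r`. -/
theorem mean_flatNormSq_le (r : ℝ≥0) (q : PMF (Fin n)) :
    ((poissonSamples r q).mean fun F => r * flatNormSq F q) ≤ 1 := by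
  simp only [flatNormSq_eq, Finset.mul_sum, PMF.mean_sum]
  have hq : ∑ x, q x = 1 := by rw [← tsum_fintype (L := .unconditional _), q.tsum_coe]
  rw [← hq]
  refine Finset.sum_le_sum fun x _ => ?_
  -- The Mecke identity with g = 1/c(x) evaluates the mean of 1/(c(x)+1). Its left side is at most
  -- 1, also at c(x) = 0, where 0 · ∞ = 0.
  have h := isPoissonProcess_poissonSamples r q x fun c => ((c x : ℕ) : ℝ≥0∞)⁻¹
  have hle : ((poissonSamples r q).mean fun F => (counts F x : ℝ≥0∞) *
      ((counts F x : ℕ) : ℝ≥0∞)⁻¹) ≤ 1 := by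
    refine (PMF.mean_mono _ fun F => ENNReal.mul_inv_le_one _).trans ?_
    rw [PMF.mean_const]
  rw [h] at hle
  simp only [Pi.add_apply, Pi.single_eq_same] at hle
  calc ((poissonSamples r q).mean fun F =>
        (r : ℝ≥0∞) * (q x * (q x * ((counts F x + 1 : ℕ) : ℝ≥0∞)⁻¹)))
      = q x * (r * q x * (poissonSamples r q).mean fun F =>
          ((counts F x + 1 : ℕ) : ℝ≥0∞)⁻¹) := by
        rw [← PMF.mean_mul_left, ← PMF.mean_mul_left]
        congr 1
        funext F
        ring
    _ ≤ q x * 1 := by gcongr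
    _ = q x := mul_one _

end Flattening

end ClosenessTesting

/-! ### Sample budget, union bound and correctness -/

namespace ClosenessTesting

variable {n s : ℕ}

theorem mean_tester (ε k : ℝ) (q : PMF (Fin n)) (p : Fin s → PMF (Fin n))
    (f : Verdict × ℕ → ℝ≥0∞) :
    (tester ε k q p).mean f = (poissonSamples k.toNNReal q).mean fun F =>
      (poissonSamples (s : ℝ≥0) (flatten F q)).mean fun Y =>
        (sourceSamples (List.ofFn fun i => flatten F (p i))).mean fun T =>
          f (verdict ε s T Y, F.length + Y.length + T.length) := by
  simp only [tester, PMF.mean_bind, PMF.mean_pure]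

theorem mean_length_poissonSamples {α : Type} [DecidableEq α] [Fintype α] (r : ℝ≥0) (p : PMF α) :
    ((poissonSamples r p).mean fun l => (l.length : ℝ≥0∞)) = r := by
  rw [(isPoissonProcess_poissonSamples r p).mean_length, ← Finset.mul_sum,
    ← tsum_fintype (L := .unconditional _), p.tsum_coe, mul_one]

theorem mean_length_sourceSamples {α : Type} [DecidableEq α] [Fintype α] (p : Fin s → PMF α) :
    ((sourceSamples (List.ofFn p)).mean fun l => (l.length : ℝ≥0∞)) = s := by
  rw [(isPoissonProcess_sourceSamples _).mean_length]
  simp only [List.map_ofFn, List.sum_ofFn, Function.comp_apply]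
  rw [Finset.sum_comm]
  have : ∀ i, ∑ z, p i z = 1 := fun i => by
    rw [← tsum_fintype (L := .unconditional _), (p i).tsum_coe]
  simp [this]

theorem expectedSamples_eq (ε k : ℝ) (q : PMF (Fin n)) (p : Fin s → PMF (Fin n)) :
    expectedSamples ε k q p = ENNReal.ofReal k + s + s := by
  have h : expectedSamples ε k q p = (tester ε k q p).mean fun o => (o.2 : ℝ≥0∞) := rfl
  rw [h, mean_tester]
  simp only [Nat.cast_add, PMF.mean_add, PMF.mean_const, mean_length_sourceSamples,
    mean_length_poissonSamples]
  simp [ENNReal.ofReal]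

-- Pointwise, the output is good, or the verdict is wrong, or the sample count divided by B is at
-- least 1 (Markov).
open Classical in
theorem one_le_outputProb_add (ε k : ℝ) (q : PMF (Fin n)) (p : Fin s → PMF (Fin n))
    (v : Verdict) {B : ℝ} (hB : 0 < B) :
    1 ≤ outputProb ε k q p v B +
      ((tester ε k q p).mean fun o => if o.1 ≠ v then 1 else 0) +
      (ENNReal.ofReal B)⁻¹ * expectedSamples ε k q p := by
  have h : expectedSamples ε k q p = (tester ε k q p).mean fun o => (o.2 : ℝ≥0∞) := rfl
  rw [outputProb, PMF.toOuterMeasure_eq_mean, h, ← PMF.mean_mul_left, ← PMF.mean_add,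
    ← PMF.mean_add]
  refine ((tester ε k q p).mean_const 1).ge.trans (PMF.mean_mono _ fun o => ?_)
  by_cases h1 : o.1 = v
  · by_cases h2 : (o.2 : ℝ) ≤ B
    · simp [h1, h2]
    · have hB' : ENNReal.ofReal B ≠ 0 := by simpa using hB
      have h3 : ENNReal.ofReal B ≤ (o.2 : ℝ≥0∞) := by
        rw [← ENNReal.ofReal_natCast]
        exact ENNReal.ofReal_le_ofReal (not_le.1 h2).le
      refine le_trans ?_ le_add_self
      rw [← ENNReal.inv_mul_cancel hB' ENNReal.ofReal_ne_top]
      gcongr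
  · simp [h1]

open Classical in
/-- A union bound over the flattening, the verdict and the sample budget. -/
theorem outputProb_ge (hn : 1 ≤ n) {ε k B : ℝ} (q : PMF (Fin n)) (p : Fin s → PMF (Fin n))
    (v : Verdict) (hk : 0 < k) (hkn : k ≤ n) (hB : 10 * (k + 2 * s) ≤ B)
    (hv : ∀ F : List (Fin n), F.length ≤ 20 * n →
      ENNReal.ofReal k * flatNormSq F q ≤ 20 →
      ((poissonSamples (s : ℝ≥0) (flatten F q)).mean fun Y =>
        (sourceSamples (List.ofFn fun i => flatten F (p i))).mean fun T =>
          if verdict ε s T Y ≠ v then 1 else 0) ≤ ENNReal.ofReal (1 / 10)) :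
    2 / 3 ≤ outputProb ε k q p v B := by
  have hn0 : (n : ℝ≥0∞) ≠ 0 := by simp; omega
  have hB0 : 0 < B := by
    have : (0 : ℝ) ≤ s := Nat.cast_nonneg s
    linarith
  have hkk : (k.toNNReal : ℝ≥0∞) = ENNReal.ofReal k := rfl
  have hwrong : ((tester ε k q p).mean fun o => if o.1 ≠ v then 1 else 0) ≤
      ENNReal.ofReal (1 / 10) + 20⁻¹ + 20⁻¹ := by
    rw [mean_tester]
    -- For a bad F one of the two Markov terms is already at least 1, and the error probability is
    -- at most 1.
    calc _ ≤ (poissonSamples k.toNNReal q).mean fun F => ENNReal.ofReal (1 / 10) +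
          (20 * (n : ℝ≥0∞))⁻¹ * F.length + 20⁻¹ * (k.toNNReal * flatNormSq F q) := by
          refine PMF.mean_mono _ fun F => ?_
          by_cases h1 : F.length ≤ 20 * n
          · by_cases h2 : ENNReal.ofReal k * flatNormSq F q ≤ 20
            · exact (hv F h1 h2).trans (le_add_right le_self_add)
            · refine le_trans ?_ le_add_self
              refine le_trans (b := 1) ?_ ?_
              · refine PMF.mean_le_one _ fun Y => PMF.mean_le_one _ fun T => ?_
                split_ifs <;> simp
              · rw [← ENNReal.inv_mul_cancel (a := 20) (by simp) (by simp)]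
                gcongr
                exact (not_le.1 h2).le
          · refine le_trans ?_ (le_add_right le_add_self)
            refine le_trans (b := 1) ?_ ?_
            · refine PMF.mean_le_one _ fun Y => PMF.mean_le_one _ fun T => ?_
              split_ifs <;> simp
            · rw [← ENNReal.inv_mul_cancel (a := 20 * (n : ℝ≥0∞)) (by simp [hn0])
                (ENNReal.mul_ne_top (by simp) (by simp))]
              gcongr
              exact_mod_cast (not_le.1 h1).le
      _ = ENNReal.ofReal (1 / 10) + (20 * (n : ℝ≥0∞))⁻¹ * ENNReal.ofReal k +
          20⁻¹ * (poissonSamples k.toNNReal q).mean fun F => k.toNNReal * flatNormSq F q := by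
          simp only [PMF.mean_add, PMF.mean_mul_left, PMF.mean_const, mean_length_poissonSamples,
            hkk]
      _ ≤ ENNReal.ofReal (1 / 10) + (20 * (n : ℝ≥0∞))⁻¹ * n + 20⁻¹ * 1 := by
          gcongr
          · rw [← ENNReal.ofReal_natCast]
            exact ENNReal.ofReal_le_ofReal hkn
          · exact mean_flatNormSq_le _ q
      _ = _ := by
          rw [mul_one, ENNReal.mul_inv (by simp) (by simp), mul_assoc,
            ENNReal.inv_mul_cancel hn0 (by simp), mul_one]
  have hbudget : (ENNReal.ofReal B)⁻¹ * expectedSamples ε k q p ≤ 10⁻¹ := by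
    have hB' : ENNReal.ofReal B ≠ 0 := by simpa using hB0
    rw [← ENNReal.mul_le_mul_iff_right hB' ENNReal.ofReal_ne_top, ← mul_assoc,
      ENNReal.mul_inv_cancel hB' ENNReal.ofReal_ne_top, one_mul, expectedSamples_eq,
      ← div_eq_mul_inv, ENNReal.le_div_iff_mul_le (by simp) (by simp)]
    have e : (ENNReal.ofReal k + s + s) * 10 = ENNReal.ofReal ((k + s + s) * 10) := by
      rw [ENNReal.ofReal_mul (by positivity), ENNReal.ofReal_add (by positivity) (by positivity),
        ENNReal.ofReal_add (by positivity) (by positivity)]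
      simp
    rw [e]
    exact ENNReal.ofReal_le_ofReal (by linarith)
  have h := one_le_outputProb_add ε k q p v hB0
  have htot : 1 ≤ outputProb ε k q p v B + 3 / 10 := by
    refine h.trans ?_
    rw [add_assoc]
    gcongr
    refine (add_le_add hwrong hbudget).trans (le_of_eq ?_)
    rw [← ENNReal.toReal_eq_toReal_iff' (by finiteness) (by finiteness)]
    rw [ENNReal.toReal_add (by finiteness) (by finiteness),
      ENNReal.toReal_add (by finiteness) (by finiteness),
      ENNReal.toReal_add (by finiteness) (by finiteness)]
    simp
    norm_num
  by_contra hlt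
  rw [not_le] at hlt
  have : outputProb ε k q p v B + 3 / 10 < 1 := by
    calc outputProb ε k q p v B + 3 / 10 < 2 / 3 + 3 / 10 :=
          ENNReal.add_lt_add_right (by finiteness) hlt
      _ ≤ 1 := by
          rw [← ENNReal.toReal_le_toReal (by finiteness) (by finiteness),
            ENNReal.toReal_add (by finiteness) (by finiteness)]
          simp
          norm_num
  exact absurd htot (not_le.2 this)

theorem isPoissonProcess_query (F : List (Fin n)) (q : PMF (Fin n)) (s : ℕ) :
    IsPoissonProcess (poissonSamples (s : ℝ≥0) (flatten F q))
      fun z => ((s * (flatten F q z).toNNReal : ℝ≥0) : ℝ≥0∞) := by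
  convert! isPoissonProcess_poissonSamples (s : ℝ≥0) (flatten F q) using 2 with z
  rw [ENNReal.coe_mul, ENNReal.coe_toNNReal ((flatten F q).apply_ne_top z)]

theorem isPoissonProcess_sources (F : List (Fin n)) (p : Fin s → PMF (Fin n)) :
    IsPoissonProcess (sourceSamples (List.ofFn fun i => flatten F (p i)))
      fun z => ((∑ i, (flatten F (p i) z).toNNReal : ℝ≥0) : ℝ≥0∞) := by
  convert! isPoissonProcess_sourceSamples (List.ofFn fun i => flatten F (p i)) using 2 with z
  rw [List.map_ofFn, List.sum_ofFn, ENNReal.ofNNReal_finsetSum]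
  exact Finset.sum_congr rfl fun i _ => ENNReal.coe_toNNReal ((flatten F (p i)).apply_ne_top z)

theorem testerCorrect {ε k B : ℝ} (hn : 1 ≤ n) (hε : 0 < ε) (hε2 : ε ≤ 2) (hk : 0 < k)
    (hkn : k ≤ n) (hs : 10 ^ 5 * (n : ℝ) / (ε ^ 2 * Real.sqrt k) ≤ s)
    (hB : 10 * (k + 2 * s) ≤ B) : TesterCorrect n ε k s B := by
  have hn' : (1 : ℝ) ≤ n := by exact_mod_cast hn
  have hR : 0 < Real.sqrt k := Real.sqrt_pos.2 hk
  have hs0 : (0 : ℝ) < s := lt_of_lt_of_le (by positivity) hs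
  intro q p
  have good : ∀ F : List (Fin n), F.length ≤ 20 * n → ENNReal.ofReal k * flatNormSq F q ≤ 20 →
      ∃ L : ℝ, 0 ≤ L ∧
        ∑ z, (((s * (flatten F q z).toNNReal : ℝ≥0)) : ℝ) ^ 2 = L ^ 2 ∧
        (Fintype.card (FlatDomain F) : ℝ) * L ≤ 21 / 20000 * ((s : ℝ) ^ 2 * ε ^ 2) ∧
        (Fintype.card (FlatDomain F) : ℝ) * 10 ^ 8 ≤ (s : ℝ) ^ 2 * ε ^ 2 := by
    intro F hF hF2
    have hnorm : (flatNormSq F q).toReal = ∑ z, (flatten F q z).toReal ^ 2 := by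
      rw [flatNormSq, ENNReal.toReal_sum fun z _ => ENNReal.pow_ne_top ((flatten F q).apply_ne_top z)]
      simp
    have hsq : Real.sqrt (flatNormSq F q).toReal ^ 2 = (flatNormSq F q).toReal :=
      Real.sq_sqrt ENNReal.toReal_nonneg
    have hw : k * Real.sqrt (flatNormSq F q).toReal ^ 2 ≤ 20 := by
      have := ENNReal.toReal_mono (by simp) hF2
      rw [ENNReal.toReal_mul, ENNReal.toReal_ofReal hk.le] at this
      rw [hsq]
      simpa using this
    have hd : (Fintype.card (FlatDomain F) : ℝ) ≤ 21 * n := by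
      rw [card_flatDomain]
      have : (F.length : ℝ) ≤ 20 * n := by exact_mod_cast hF
      push_cast
      linarith
    have hpar := parameters hn' hε hε2 hk hkn hs (Real.sqrt_nonneg _) hw hd
    -- L is the ℓ₂ norm of the intensity of the query samples.
    refine ⟨s * Real.sqrt (flatNormSq F q).toReal, by positivity, ?_, hpar⟩
    rw [mul_pow, hsq, hnorm, Finset.mul_sum]
    refine Finset.sum_congr rfl fun z _ => ?_
    rw [← mul_pow]
    simp [ENNReal.coe_toNNReal_eq_toReal]
  have hne : ∀ F : List (Fin n), Nonempty (FlatDomain F) := fun F => ⟨⟨⟨0, hn⟩, ⟨0, Nat.succ_pos _⟩⟩⟩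
  refine ⟨fun hp => ?_, fun hfar hst => ?_, ?_⟩
  · refine outputProb_ge hn q p _ hk hkn hB fun F hF hF2 => ?_
    obtain ⟨L, hL0, hL, h1, -⟩ := good F hF hF2
    have := hne F
    have hP : IsPoissonProcess (sourceSamples (List.ofFn fun i => flatten F (p i)))
        fun z => ((s * (flatten F q z).toNNReal : ℝ≥0) : ℝ≥0∞) := by
      have h := isPoissonProcess_sources F p
      simpa [hp] using h
    exact accept_of_equal hP (isPoissonProcess_query F q s) (by positivity) hL0 hL h1
  · refine outputProb_ge hn q p _ hk hkn hB fun F hF hF2 => ?_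
    obtain ⟨L, hL0, hL, h1, h2⟩ := good F hF hF2
    have := hne F
    refine reject_of_far (isPoissonProcess_sources F p) (isPoissonProcess_query F q s)
      (by positivity) hL0 hL ?_ h1 h2
    simpa [ENNReal.coe_toNNReal_eq_toReal] using sum_abs_flatten F q p hfar hst
  · rw [expectedSamples_eq]
    have e : ENNReal.ofReal k + s + s = ENNReal.ofReal (k + s + s) := by
      rw [ENNReal.ofReal_add (by positivity) (by positivity),
        ENNReal.ofReal_add (by positivity) (by positivity)]
      simp
    rw [e]
    exact ENNReal.ofReal_le_ofReal (by linarith)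

end ClosenessTesting

theorem theorem4 :
    ∃ c₁ > (0 : ℝ), ∃ C > (0 : ℝ), ∀ (n : ℕ) (ε : ℝ), 1 ≤ n → 0 < ε → ε ≤ 2 →
      (∀ k : ℝ, 0 < k → k ≤ (n : ℝ) →
        ClosenessTesting.TesterCorrect n ε k (ClosenessTesting.numSources c₁ n ε k)
          (C * (k + (n : ℝ) / (ε ^ 2 * Real.sqrt k)))) ∧
      ClosenessTesting.TesterCorrect n ε (ClosenessTesting.bestK n ε)
        (ClosenessTesting.numSources c₁ n ε (ClosenessTesting.bestK n ε))
        (C * ((n : ℝ) ^ (2 / 3 : ℝ) / ε ^ (4 / 3 : ℝ) + Real.sqrt n / ε ^ 2)) := by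
  have budget : ∀ (n : ℕ) (ε k : ℝ), 1 ≤ n → 0 < ε → ε ≤ 2 → 0 < k → k ≤ n →
      10 * (k + 2 * (ClosenessTesting.numSources (10 ^ 5) n ε k : ℝ)) ≤
        10 ^ 7 * (k + (n : ℝ) / (ε ^ 2 * Real.sqrt k)) := by
    intro n ε k hn hε hε2 hk hkn
    have h := ClosenessTesting.numSources_le hn hε hε2 hk hkn
    have h0 : 0 ≤ (n : ℝ) / (ε ^ 2 * Real.sqrt k) := by positivity
    linarith
  -- The value 10⁵ is the one used in `parameters`; 10⁷ exceeds 20 · (10⁵ + 4) from `budget`, and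
  -- the factor 2 comes from `bestK_cost`.
  refine ⟨10 ^ 5, by norm_num, 2 * 10 ^ 7, by norm_num, fun n ε hn hε hε2 => ⟨?_, ?_⟩⟩
  · intro k hk hkn
    refine ClosenessTesting.testerCorrect hn hε hε2 hk hkn (Nat.le_ceil _) ?_
    have h0 : 0 ≤ (n : ℝ) / (ε ^ 2 * Real.sqrt k) := by positivity
    have h := budget n ε k hn hε hε2 hk hkn
    linarith
  · have hk := ClosenessTesting.bestK_pos hn hε
    have hkn : ClosenessTesting.bestK n ε ≤ n := min_le_left _ _
    refine ClosenessTesting.testerCorrect hn hε hε2 hk hkn (Nat.le_ceil _) ?_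
    have h := budget n ε _ hn hε hε2 hk hkn
    have h' := ClosenessTesting.bestK_cost hn hε
    linarith
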